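/- Let $n$ be a dimension and $Q_0=[-1,1]^n$. Write points of the upper half-space $\mathbb{R}^{n+1}_+=\mathbb{R}^n\times(0,\infty)$ as $(x,t)$ and identify $(x,t)$ with the closed axis-parallel cube $Q=x+tQ_0$, of side length $\ell(Q)=2t$; for a function $a$ on $\mathbb{R}^{n+1}_+$ put $a(Q):=a(x,t)$. Let $|E|$ be Lebesgue measure, $\operatorname{avg}_Q g=\frac1{|Q|}\int_Q g$, and $\operatorname{osc}(f,Q)=\operatorname{avg}_Q|f-\operatorname{avg}_Q f|$. For $1<p<\infty$, $JN_p(\mathbb{R}^n)$ is the space of (real- or complex-valued) $f\in L^1_{\mathrm{loc}}(\mathbb{R}^n)$ with $$\|f\|_{JN_p}:=\Big(\sup_{\mathcal C}\sum_{Q\in\mathcal C}\operatorname{osc}(f,Q)^p|Q|\Big)^{1/p}<\infty ,$$ and $S^1(Q_0)$ is the space of continuous $F:\mathbb{R}^{n+1}_+\to\mathbb{R}$ with $\|F\|_{S^1(Q_0)}:=\sup_{\mathcal C}\sum_{Q\in\mathcal C}|F(Q)|<\infty$; both suprema are over all finite collections $\mathcal C$ of pairwise disjoint closed cubes. There is a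 constant $C=C(n)>0$, depending only on $n$, such that for all $1<p<\infty$, $f\in JN_p(\mathbb{R}^n)$ and $0<\delta<1$ there are numbers $\lambda_i\ge 0$, real functions $g_i\in L^1(\mathbb{R}^n)$ with $\|g_i\|_{L^1}=1$, and real functions $a_i\in C_c(\mathbb{R}^{n+1}_+)$ with $|a_i|\le1$ ($i\ge 1$) such that $$\operatorname{osc}(f,Q)^p=\sum_{i=1}^\infty\lambda_i\,a_i(Q)\operatorname{avg}_Q g_i\quad\text{for every cube }Q\text{ with }\delta<\ell(Q)<\delta^{-1},\qquad \sum_{i=1}^\infty\lambda_i\le C\,\|f\|_{JN_p}^p .$$ If $\|f\|_{JN_p}\neq0$, all $\lambda_i$ are strictly positive. Moreover, there is a function $G$ on $\mathbb{R}^{n+1}_+$, equal to $\operatorname{osc}(f,Q)^p$ whenever $\delta<\ell(Q)<\delta^{-1}$, such that the series $\sum_i\lambda_i a_i(Q)\operatorname{avg}_Q g_i$ converges to $G(Q)$ in $S^1(Q_0)$ and uniformly on all of $\mathbb{R}^{n+1}_+$, and the series $\sum_i\lambda_i a_i(Q)\int_Q g_i$ converges to $|Q|\,G(Q)$ in $S^1(Q_0)$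 (all terms and both limits lie in $S^1(Q_0)$). -/

import Mathlib

open MeasureTheory Filter Topology
open scoped ENNReal

namespace JNp

noncomputable section

/-- The open upper half-space `ℝⁿ × (0, ∞)`. A point `(x, t)` also stands for the closed cube
`x + t Q₀`, where `Q₀ = [-1, 1]ⁿ`. -/
abbrev UpperHalfSpace (n : ℕ) : Type := (Fin n → ℝ) × Set.Ioi (0 : ℝ)

/-- The closed axis-parallel cube `x + t Q₀` that belongs to `(x, t)`. The space `Fin n → ℝ`
carries the sup norm, so this is a closed ball; see `mem_cube`. -/
def cube {n : ℕ} (Q : UpperHalfSpace n) : Set (Fin n → ℝ) :=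
  Metric.closedBall Q.1 (Q.2 : ℝ)

theorem mem_cube {n : ℕ} (Q : UpperHalfSpace n) (y : Fin n → ℝ) :
    y ∈ cube Q ↔ ∀ i, |y i - Q.1 i| ≤ (Q.2 : ℝ) := by
  have h : (0 : ℝ) ≤ (Q.2 : ℝ) := le_of_lt Q.2.2
  simp [cube, Metric.mem_closedBall, dist_pi_le_iff h, Real.dist_eq]

/-- The side length of the cube `x + t Q₀` is `2 t`. -/
def sideLength {n : ℕ} (Q : UpperHalfSpace n) : ℝ := 2 * (Q.2 : ℝ)

/-- The mean oscillation of `f` over the cube `Q`. -/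
def osc {n : ℕ} {𝕜 : Type*} [RCLike 𝕜] (f : (Fin n → ℝ) → 𝕜) (Q : UpperHalfSpace n) : ℝ :=
  ⨍ y in cube Q, ‖f y - ⨍ z in cube Q, f z‖

/-- The John–Nirenberg norm: supremum over finite collections of pairwise disjoint closed cubes. -/
def jnNorm {n : ℕ} {𝕜 : Type*} [RCLike 𝕜] (p : ℝ) (f : (Fin n → ℝ) → 𝕜) : ℝ≥0∞ :=
  (⨆ (𝒞 : Finset (UpperHalfSpace n)) (_ : (𝒞 : Set (UpperHalfSpace n)).PairwiseDisjoint cube),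
    ∑ Q ∈ 𝒞, ENNReal.ofReal (osc f Q) ^ p * volume (cube Q)) ^ (1 / p)

/-- Membership in the John–Nirenberg space of exponent `p`. -/
def MemJN {n : ℕ} {𝕜 : Type*} [RCLike 𝕜] (p : ℝ) (f : (Fin n → ℝ) → 𝕜) : Prop :=
  LocallyIntegrable f volume ∧ jnNorm p f < ∞

/-- The norm of the tent space `S^p(Q₀)`. -/
def tentNorm {n : ℕ} (p : ℝ) (F : UpperHalfSpace n → ℝ) : ℝ≥0∞ :=
  (⨆ (𝒞 : Finset (UpperHalfSpace n)) (_ : (𝒞 : Set (UpperHalfSpace n)).PairwiseDisjoint cube),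
    ∑ Q ∈ 𝒞, ‖F Q‖ₑ ^ p) ^ (1 / p)

/-- Membership in the tent space `S^p(Q₀)`. -/
def MemTent {n : ℕ} (p : ℝ) (F : UpperHalfSpace n → ℝ) : Prop :=
  Continuous F ∧ tentNorm p F < ∞

/-- The series `∑ u i` of elements of `S^p(Q₀)` converges to `F ∈ S^p(Q₀)` in norm. -/
def TentHasSum {n : ℕ} (p : ℝ) (u : ℕ → UpperHalfSpace n → ℝ) (F : UpperHalfSpace n → ℝ) : Prop :=
  (∀ i, MemTent p (u i)) ∧ MemTent p F ∧
    Tendsto (fun N : ℕ => tentNorm p (fun Q => F Q - ∑ i ∈ Finset.range N, u i Q)) atTop (𝓝 0)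

end

end JNp

/-!
Multiply `osc f Q ^ p` by a cutoff in the side length to get a continuous `G ≥ 0` supported in a
strip `t₀ ≤ t ≤ t₁`. The function `F Q = |Q| G(Q)` has `S¹` norm at most `‖f‖ ^ p`, the `p`-th power
of the John–Nirenberg norm.

The heart of the matter is that a continuous compactly supported `F ≥ 0` in `S¹` is dominated by
`∫_Q g` for a single density `g` with `∫ g ≤ (2 ^ n + 1) ‖F‖` (`exists_dominating_density`). For a
finite family of cubes this is a statement about packings (`exists_weights_of_finset`): treating the
cubes in order of increasing size and charging each one with what is left of `F` after deducting the
charges of the smaller cubes that meet it, one gets weights whose total is at most the sum of `F` over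
a disjoint subfamily, hence at most `‖F‖`. If a small cube meets a larger one, one of its `2 ^ n`
corners lies in the larger one (`exists_corner_mem_cube`), so point masses at the corners, weighted
accordingly, dominate `F`. Compactness, mollification, and a positive integrable function of small
mass give the continuous version. The quotient `a Q = F Q / ∫_Q g` is then continuous and compactly
supported with values in `[0, 1]`, and `F Q = a Q * ∫_Q g` is a decomposition with a single term.

For functions supported in the strip, the part of `F` that belongs to cubes with distant centres is
small in `S¹` (`exists_tentNorm_one_tail_le`). Hence there are spatial cutoffs for which the remainders
decay geometrically (`exists_cutoffs`), and applying the above to the differences of consecutive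
cutoffs gives the series, with `∑ λ_i ≤ 2 (2 ^ n + 1) ‖f‖ ^ p` (`exists_decomposition`). Since `|Q|` is
bounded below on the strip, convergence of the series for `F` in `S¹` implies that for `G`, and the
`S¹` norm dominates the supremum norm.
-/

namespace JNp

variable {n : ℕ}

/-! ### Geometry of cubes -/

theorem measurableSet_cube (Q : UpperHalfSpace n) : MeasurableSet (cube Q) :=
  Metric.isClosed_closedBall.measurableSet

theorem measure_cube_ne_top (Q : UpperHalfSpace n) : volume (cube Q) ≠ ∞ :=
  (isCompact_closedBall _ _).measure_lt_top.ne

theorem not_disjoint_cube_self (Q : UpperHalfSpace n) : ¬ Disjoint (cube Q) (cube Q) :=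
  Set.not_disjoint_iff.2
    ⟨Q.1, Metric.mem_closedBall_self Q.2.2.le, Metric.mem_closedBall_self Q.2.2.le⟩

/-- The corner of the cube `Q` in the direction `σ`. -/
def corner (Q : UpperHalfSpace n) (σ : Fin n → Bool) : Fin n → ℝ :=
  fun i => if σ i then Q.1 i + Q.2 else Q.1 i - Q.2

theorem exists_corner_mem_cube {v u : UpperHalfSpace n} (hvu : (v.2 : ℝ) ≤ u.2)
    (h : ¬ Disjoint (cube v) (cube u)) : ∃ σ, corner v σ ∈ cube u := by
  obtain ⟨y, hyv, hyu⟩ := Set.not_disjoint_iff.1 h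
  rw [mem_cube] at hyv hyu
  refine ⟨fun i => decide (v.1 i ≤ u.1 i), (mem_cube _ _).2 fun i => ?_⟩
  have h1 := abs_le.1 (hyv i)
  have h2 := abs_le.1 (hyu i)
  have hv : 0 < (v.2 : ℝ) := v.2.2
  rw [abs_le]
  by_cases hi : v.1 i ≤ u.1 i
  · simp only [corner, hi, decide_true, if_true]
    constructor <;> linarith
  · simp only [corner, hi, decide_false, Bool.false_eq_true, if_false]
    constructor <;> linarith

theorem measureReal_cube (Q : UpperHalfSpace n) :
    volume.real (cube Q) = (2 * (Q.2 : ℝ)) ^ n := by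
  have h : (0 : ℝ) ≤ (Q.2 : ℝ) := le_of_lt Q.2.2
  rw [Measure.real, cube, Real.volume_pi_closedBall _ h, Fintype.card_fin,
    ENNReal.toReal_ofReal (by positivity)]

theorem measureReal_cube_pos (Q : UpperHalfSpace n) : 0 < volume.real (cube Q) := by
  have h : (0 : ℝ) < (Q.2 : ℝ) := Q.2.2
  rw [measureReal_cube]
  positivity

theorem continuous_measureReal_cube :
    Continuous fun Q : UpperHalfSpace n => volume.real (cube Q) := by
  simp only [measureReal_cube]
  fun_prop

theorem integral_indicator_cube (Q : UpperHalfSpace n) :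
    ∫ y, (cube Q).indicator (fun _ => (volume.real (cube Q))⁻¹) y = 1 := by
  rw [integral_indicator (measurableSet_cube Q), setIntegral_const, smul_eq_mul,
    mul_inv_cancel₀ (measureReal_cube_pos Q).ne']

theorem integrable_indicator_cube (Q : UpperHalfSpace n) :
    Integrable ((cube Q).indicator fun _ => (volume.real (cube Q))⁻¹) volume :=
  (integrable_indicator_iff (measurableSet_cube Q)).2 (integrableOn_const (measure_cube_ne_top Q))

theorem setIntegral_cube_pos {g : (Fin n → ℝ) → ℝ} (hg : Integrable g volume)
    (hg0 : ∀ y, 0 < g y) (Q : UpperHalfSpace n) : 0 < ∫ y in cube Q, g y := by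
  refine (setIntegral_pos_iff_support_of_nonneg_ae (.of_forall fun y => (hg0 y).le)
    hg.integrableOn).2 ?_
  rw [Set.eq_univ_of_forall (s := Function.support g) fun y => (hg0 y).ne', Set.univ_inter]
  exact Metric.measure_closedBall_pos _ _ Q.2.2

/-! ### Weights for finite families of cubes -/

open Classical in
/-- Fractional against integral packing. Treating the cubes of `N` in order of increasing size, and
charging each cube with what is left of `F` after deducting the charges of the smaller cubes that
meet it, yields weights `r` whose total is at most the sum of `F` over a disjoint subfamily, while
`F u` is at most the total weight of the cubes that are no larger than `u` and meet `u`. -/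
theorem exists_weights_of_finset (N : Finset (UpperHalfSpace n)) (F : UpperHalfSpace n → ℝ) :
    ∃ r : UpperHalfSpace n → ℝ, (∀ v, 0 ≤ r v) ∧
      (∃ S : Finset (UpperHalfSpace n), (S : Set (UpperHalfSpace n)).PairwiseDisjoint cube ∧
        S ⊆ N ∧ ∑ v ∈ N, r v ≤ ∑ v ∈ S, F v) ∧
      ∀ u ∈ N, F u ≤
        ∑ v ∈ N with (v.2 : ℝ) ≤ u.2 ∧ ¬ Disjoint (cube v) (cube u), r v := by
  induction N using Finset.induction_on_min_value (fun Q : UpperHalfSpace n => (Q.2 : ℝ))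
    generalizing F with
  | empty => exact ⟨0, fun _ => le_rfl, ⟨∅, by simp, by simp, by simp⟩, by simp⟩
  | insert v N hv hmin ih =>
    -- charge the smallest cube `v` with the weight `w`, and deduct `w` from the cubes that meet `v`
    set w : ℝ := max (F v) 0 with hw
    have hw0 : 0 ≤ w := le_max_right _ _
    obtain ⟨r, hr, ⟨S, hSd, hSN, hS⟩, hdom⟩ :=
      ih (fun u => if Disjoint (cube v) (cube u) then F u else F u - w)
    have hne : ∀ x ∈ N, x ≠ v := fun x hx h => hv (h ▸ hx)
    have hr' : ∀ x, 0 ≤ Function.update r v w x := fun x => by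
      rcases eq_or_ne x v with rfl | h
      · simpa using hw0
      · simpa [h] using hr x
    have hsum : ∑ x ∈ N, Function.update r v w x = ∑ x ∈ N, r x :=
      Finset.sum_congr rfl fun x hx => by simp [hne x hx]
    refine ⟨Function.update r v w, hr', ?_, ?_⟩
    · rw [Finset.sum_insert hv, hsum, Function.update_self]
      have hle : ∀ x ∈ S, (if Disjoint (cube v) (cube x) then F x else F x - w) ≤ F x := by
        intro x _
        split_ifs <;> linarith
      -- if `S` meets `v`, the deduction already pays for `w`; otherwise `v` may join `S`
      by_cases hmeet : ∃ u ∈ S, ¬ Disjoint (cube v) (cube u)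
      · obtain ⟨u, huS, hu⟩ := hmeet
        refine ⟨S, hSd, hSN.trans (Finset.subset_insert _ _), ?_⟩
        rw [← Finset.add_sum_erase S _ huS] at hS ⊢
        rw [if_neg hu] at hS
        have := Finset.sum_le_sum fun x (hx : x ∈ S.erase u) => hle x (Finset.mem_of_mem_erase hx)
        linarith
      · push Not at hmeet
        have hSF : ∑ x ∈ N, r x ≤ ∑ x ∈ S, F x := hS.trans (Finset.sum_le_sum hle)
        rcases le_total (F v) 0 with h | h
        · refine ⟨S, hSd, hSN.trans (Finset.subset_insert _ _), ?_⟩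
          rw [hw, max_eq_right h]
          linarith
        · refine ⟨insert v S, ?_, Finset.insert_subset_insert _ hSN, ?_⟩
          · rw [Finset.coe_insert]
            exact hSd.insert fun u hu _ => hmeet u hu
          · rw [Finset.sum_insert fun hvS => hv (hSN hvS), hw, max_eq_left h]
            linarith
    · intro u hu
      rw [Finset.sum_filter, Finset.sum_insert hv, Function.update_self]
      have hnn : ∀ u : UpperHalfSpace n, 0 ≤ ∑ x ∈ N,
          if (x.2 : ℝ) ≤ u.2 ∧ ¬ Disjoint (cube x) (cube u) then Function.update r v w x else 0 :=
        fun u => Finset.sum_nonneg fun x _ => by split_ifs <;> [exact hr' x; exact le_rfl]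
      rcases Finset.mem_insert.1 hu with rfl | huN
      · rw [if_pos ⟨le_rfl, not_disjoint_cube_self u⟩]
        linarith [hnn u, le_max_left (F u) 0]
      · have h1 := hdom u huN
        have h2 : ∑ x ∈ N, (if (x.2 : ℝ) ≤ u.2 ∧ ¬ Disjoint (cube x) (cube u) then
            Function.update r v w x else 0) =
            ∑ x ∈ N with (x.2 : ℝ) ≤ u.2 ∧ ¬ Disjoint (cube x) (cube u), r x := by
          rw [Finset.sum_filter]
          exact Finset.sum_congr rfl fun x hx => by simp [hne x hx]
        rw [h2]
        by_cases hd : Disjoint (cube v) (cube u)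
        · rw [if_pos hd] at h1
          simpa [hd] using h1
        · rw [if_neg hd] at h1
          rw [if_pos ⟨hmin u huN, hd⟩]
          linarith

/-! ### Continuity in the cube -/

/-- Integrals over the cube `Q` depend continuously on `Q`: the boundary of a cube is a null set. -/
theorem continuousAt_setIntegral_cube {E : Type*} [NormedAddCommGroup E] [NormedSpace ℝ E]
    {Φ : UpperHalfSpace n → (Fin n → ℝ) → E} {b : (Fin n → ℝ) → ℝ} {Q₀ : UpperHalfSpace n}
    (hm : ∀ Q, AEStronglyMeasurable (Φ Q) volume) (hc : ∀ y, ContinuousAt (fun Q => Φ Q y) Q₀)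
    (hb : LocallyIntegrable b volume) (hΦ : ∀ᶠ Q in 𝓝 Q₀, ∀ y, ‖Φ Q y‖ ≤ b y) :
    ContinuousAt (fun Q => ∫ y in cube Q, Φ Q y) Q₀ := by
  have hK : MeasurableSet (Metric.closedBall Q₀.1 ((Q₀.2 : ℝ) + 1)) :=
    Metric.isClosed_closedBall.measurableSet
  have hcont : Continuous fun Q : UpperHalfSpace n => dist Q.1 Q₀.1 + (Q.2 : ℝ) := by fun_prop
  simp only [ContinuousAt, ← integral_indicator (measurableSet_cube _)]
  refine tendsto_integral_filter_of_dominated_convergence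
    ((Metric.closedBall Q₀.1 ((Q₀.2 : ℝ) + 1)).indicator b)
    (.of_forall fun Q => (hm Q).indicator (measurableSet_cube Q)) ?_
    ((hb.integrableOn_isCompact (isCompact_closedBall _ _)).integrable_indicator hK) ?_
  · have hev : ∀ᶠ Q : UpperHalfSpace n in 𝓝 Q₀, dist Q.1 Q₀.1 + (Q.2 : ℝ) < Q₀.2 + 1 :=
      hcont.continuousAt.eventually_lt_const (by simp)
    filter_upwards [hΦ, hev] with Q hQ hQ'
    refine .of_forall fun y => ?_
    by_cases hy : y ∈ cube Q
    · have hyK : y ∈ Metric.closedBall Q₀.1 ((Q₀.2 : ℝ) + 1) := by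
        have h1 : dist y Q.1 ≤ Q.2 := hy
        rw [Metric.mem_closedBall]
        linarith [dist_triangle y Q.1 Q₀.1]
      rw [Set.indicator_of_mem hy, Set.indicator_of_mem hyK]
      exact hQ y
    · rw [Set.indicator_of_notMem hy, norm_zero]
      exact Set.indicator_nonneg (fun y _ => (norm_nonneg _).trans (hQ y)) y
  · have hsph : ∀ᵐ y ∂(volume : Measure (Fin n → ℝ)), y ∉ Metric.sphere Q₀.1 (Q₀.2 : ℝ) :=
      measure_eq_zero_iff_ae_notMem.1
        (Measure.addHaar_sphere_of_ne_zero _ _ (ne_of_gt Q₀.2.2))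
    filter_upwards [hsph] with y hy
    have hd : Continuous fun Q : UpperHalfSpace n => dist y Q.1 - (Q.2 : ℝ) := by fun_prop
    rcases lt_or_gt_of_ne (show dist y Q₀.1 ≠ Q₀.2 from hy) with h | h
    · have hin : ∀ᶠ Q : UpperHalfSpace n in 𝓝 Q₀, dist y Q.1 - (Q.2 : ℝ) < 0 :=
        hd.continuousAt.eventually_lt_const (by linarith)
      rw [Set.indicator_of_mem (show y ∈ cube Q₀ from h.le)]
      refine (hc y).tendsto.congr' ?_
      filter_upwards [hin] with Q hQ
      rw [Set.indicator_of_mem]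
      exact show dist y Q.1 ≤ Q.2 by linarith
    · have hout : ∀ᶠ Q : UpperHalfSpace n in 𝓝 Q₀, 0 < dist y Q.1 - (Q.2 : ℝ) :=
        hd.continuousAt.eventually_const_lt (by linarith)
      rw [Set.indicator_of_notMem (show y ∉ cube Q₀ from not_le.2 h)]
      refine tendsto_const_nhds.congr' ?_
      filter_upwards [hout] with Q hQ
      rw [Set.indicator_of_notMem]
      exact show ¬ dist y Q.1 ≤ Q.2 by linarith

theorem continuous_setIntegral_cube {E : Type*} [NormedAddCommGroup E] [NormedSpace ℝ E]
    {g : (Fin n → ℝ) → E} (hg : LocallyIntegrable g volume) :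
    Continuous fun Q : UpperHalfSpace n => ∫ y in cube Q, g y :=
  continuous_iff_continuousAt.2 fun _ =>
    continuousAt_setIntegral_cube (fun _ => hg.aestronglyMeasurable)
      (fun _ => continuousAt_const) (fun y => (hg y).norm) (.of_forall fun _ _ => le_rfl)

theorem continuous_setAverage_cube {E : Type*} [NormedAddCommGroup E] [NormedSpace ℝ E]
    {g : (Fin n → ℝ) → E} (hg : LocallyIntegrable g volume) :
    Continuous fun Q : UpperHalfSpace n => ⨍ y in cube Q, g y := by
  simp only [setAverage_eq]
  exact (continuous_measureReal_cube.inv₀ fun Q => (measureReal_cube_pos Q).ne').smul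
    (continuous_setIntegral_cube hg)

theorem continuous_osc {𝕜 : Type*} [RCLike 𝕜] {f : (Fin n → ℝ) → 𝕜}
    (hf : LocallyIntegrable f volume) : Continuous (osc (n := n) f) := by
  have hm := continuous_setAverage_cube hf
  unfold osc
  simp only [setAverage_eq volume (fun y => ‖_‖)]
  refine (continuous_measureReal_cube.inv₀ fun Q => (measureReal_cube_pos Q).ne').smul
    (continuous_iff_continuousAt.2 fun Q₀ => ?_)
  refine continuousAt_setIntegral_cube (b := fun y => ‖f y‖ + (‖⨍ z in cube Q₀, f z‖ + 1))
    (fun Q => (hf.aestronglyMeasurable.sub aestronglyMeasurable_const).norm)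
    (fun y => (continuous_const.sub hm).norm.continuousAt)
    (LocallyIntegrable.add (fun y => (hf y).norm) (locallyIntegrable_const _)) ?_
  have hev : ∀ᶠ Q in 𝓝 Q₀, ‖⨍ z in cube Q, f z‖ < ‖⨍ z in cube Q₀, f z‖ + 1 :=
    hm.norm.continuousAt.eventually_lt_const (by linarith)
  filter_upwards [hev] with Q hQ y
  rw [norm_norm]
  exact (norm_sub_le _ _).trans (by linarith)

theorem osc_nonneg {𝕜 : Type*} [RCLike 𝕜] (f : (Fin n → ℝ) → 𝕜) (Q : UpperHalfSpace n) :
    0 ≤ osc f Q := by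
  rw [osc, setAverage_eq]
  exact smul_nonneg (by positivity) (integral_nonneg fun _ => norm_nonneg _)

/-! ### The `S¹` norm -/

theorem tentNorm_one (F : UpperHalfSpace n → ℝ) :
    tentNorm 1 F = ⨆ (𝒞 : Finset (UpperHalfSpace n))
      (_ : (𝒞 : Set (UpperHalfSpace n)).PairwiseDisjoint cube), ∑ Q ∈ 𝒞, ‖F Q‖ₑ := by
  simp [tentNorm]

theorem sum_enorm_le_tentNorm_one (F : UpperHalfSpace n → ℝ) {𝒞 : Finset (UpperHalfSpace n)}
    (h𝒞 : (𝒞 : Set (UpperHalfSpace n)).PairwiseDisjoint cube) :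
    ∑ Q ∈ 𝒞, ‖F Q‖ₑ ≤ tentNorm 1 F := by
  rw [tentNorm_one]
  exact le_iSup₂ (f := fun (𝒞 : Finset (UpperHalfSpace n))
    (_ : (𝒞 : Set (UpperHalfSpace n)).PairwiseDisjoint cube) => ∑ Q ∈ 𝒞, ‖F Q‖ₑ) 𝒞 h𝒞

theorem enorm_le_tentNorm_one (F : UpperHalfSpace n → ℝ) (Q : UpperHalfSpace n) :
    ‖F Q‖ₑ ≤ tentNorm 1 F := by
  simpa using sum_enorm_le_tentNorm_one F (𝒞 := {Q}) (by simp)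

theorem tentNorm_one_le_mul {F F' : UpperHalfSpace n → ℝ} {K : ℝ} (hK : 0 ≤ K)
    (h : ∀ Q, |F' Q| ≤ K * |F Q|) : tentNorm 1 F' ≤ ENNReal.ofReal K * tentNorm 1 F := by
  rw [tentNorm_one F']
  refine iSup₂_le fun 𝒞 h𝒞 => ?_
  refine le_trans ?_ (mul_le_mul_right (sum_enorm_le_tentNorm_one F h𝒞) _)
  rw [Finset.mul_sum]
  refine Finset.sum_le_sum fun Q _ => ?_
  rw [← ofReal_norm, ← ofReal_norm, ← ENNReal.ofReal_mul hK]
  exact ENNReal.ofReal_le_ofReal (h Q)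

theorem tentNorm_one_mono {F F' : UpperHalfSpace n → ℝ} (h : ∀ Q, |F' Q| ≤ |F Q|) :
    tentNorm 1 F' ≤ tentNorm 1 F := by
  simpa using tentNorm_one_le_mul zero_le_one (by simpa using h)

/-- If `F` has finite `S¹` norm and vanishes on large cubes, its restrictions to cubes with distant
centres are small in `S¹`: a collection that almost attains the norm of `F` lives in a bounded
region, and adding distant cubes to it cannot exceed the norm. -/
theorem exists_tentNorm_one_tail_le {F : UpperHalfSpace n → ℝ} (hF : tentNorm 1 F ≠ ∞) {T : ℝ}
    (hT : ∀ Q : UpperHalfSpace n, T < Q.2 → F Q = 0) {ε : ℝ≥0∞} (hε : ε ≠ 0) :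
    ∃ R₀ : ℝ, ∀ R ≥ R₀, ∀ F' : UpperHalfSpace n → ℝ, (∀ Q, |F' Q| ≤ |F Q|) →
      (∀ Q, ‖Q.1‖ ≤ R → F' Q = 0) → tentNorm 1 F' ≤ ε := by
  classical
  rcases eq_or_ne (tentNorm 1 F) 0 with h0 | h0
  · exact ⟨0, fun R _ F' hF' _ => (tentNorm_one_mono hF').trans (by simp [h0])⟩
  have hlt := ENNReal.sub_lt_self hF h0 hε
  nth_rewrite 2 [tentNorm_one] at hlt
  simp only [lt_iSup_iff] at hlt
  obtain ⟨𝒞, h𝒞, hlt⟩ := hlt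
  refine ⟨∑ Q ∈ 𝒞, (‖Q.1‖ + Q.2) + T, fun R hR F' hF' hR' => ?_⟩
  rw [tentNorm_one F']
  refine iSup₂_le fun 𝒟 h𝒟 => ?_
  set 𝒟' := 𝒟.filter fun Q => F' Q ≠ 0
  have hdisj : ∀ Q ∈ 𝒞, ∀ P ∈ 𝒟', Disjoint (cube Q) (cube P) := by
    intro Q hQ P hP
    have hFP : F' P ≠ 0 := (Finset.mem_filter.1 hP).2
    have hP1 : R < ‖P.1‖ := by
      by_contra h
      exact hFP (hR' P (not_lt.1 h))
    have hP2 : (P.2 : ℝ) ≤ T := by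
      by_contra h
      have := hF' P
      rw [hT P (not_le.1 h), abs_zero] at this
      exact hFP (abs_nonpos_iff.1 this)
    have hQR : ‖Q.1‖ + Q.2 ≤ ∑ Q ∈ 𝒞, (‖Q.1‖ + (Q.2 : ℝ)) :=
      Finset.single_le_sum (f := fun Q : UpperHalfSpace n => ‖Q.1‖ + (Q.2 : ℝ))
        (fun Q _ => add_nonneg (norm_nonneg _) Q.2.2.le) hQ
    rw [Set.disjoint_left]
    intro y hyQ hyP
    have h1 : dist y Q.1 ≤ Q.2 := hyQ
    have h2 : dist y P.1 ≤ P.2 := hyP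
    have h3 := dist_triangle_left P.1 Q.1 y
    rw [dist_eq_norm P.1] at h3
    have h4 := norm_le_insert' P.1 Q.1
    linarith
  have h𝒟'' : (𝒟' : Set (UpperHalfSpace n)).PairwiseDisjoint cube :=
    h𝒟.subset (Finset.coe_subset.2 (Finset.filter_subset _ _))
  have hdU : Disjoint 𝒞 𝒟' := Finset.disjoint_left.2 fun Q h1 h2 =>
    not_disjoint_cube_self Q (hdisj Q h1 Q h2)
  have hU : ((𝒞 ∪ 𝒟' : Finset _) : Set (UpperHalfSpace n)).PairwiseDisjoint cube := by
    rw [Finset.coe_union]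
    exact Set.pairwiseDisjoint_union.2 ⟨h𝒞, h𝒟'', fun Q hQ P hP _ => hdisj Q hQ P hP⟩
  have hsum := sum_enorm_le_tentNorm_one F hU
  rw [Finset.sum_union hdU] at hsum
  have hle : ∑ Q ∈ 𝒟, ‖F' Q‖ₑ ≤ ∑ Q ∈ 𝒟', ‖F Q‖ₑ := by
    rw [← Finset.sum_filter_of_ne (p := fun Q => F' Q ≠ 0) fun Q _ h => by simpa using h]
    refine Finset.sum_le_sum fun Q _ => ?_
    rw [← ofReal_norm, ← ofReal_norm]
    exact ENNReal.ofReal_le_ofReal (hF' Q)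
  refine hle.trans ?_
  have hfin : ∑ Q ∈ 𝒞, ‖F Q‖ₑ ≠ ∞ :=
    ne_top_of_le_ne_top hF (sum_enorm_le_tentNorm_one F h𝒞)
  refine (ENNReal.add_le_add_iff_left hfin).1 (hsum.trans ?_)
  exact tsub_le_iff_right.1 hlt.le

/-! ### The dominating density -/

/-- A continuous compactly supported `F ≥ 0` on the half-space is dominated by the integrals over
cubes of a positive density whose mass is at most `2 ^ n + 1` times a bound for its `S¹` norm.
A finite net of cubes is chosen, slightly inside the cubes of the support; the weights of
`exists_weights_of_finset` are spread over small cubes around the corners of the cubes of the net;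
and a positive integrable function of small mass absorbs the oscillation of `F`. -/
theorem exists_dominating_density {F : UpperHalfSpace n → ℝ} (hF : Continuous F)
    (hFc : HasCompactSupport F) (hF0 : ∀ Q, 0 ≤ F Q) {B : ℝ} (hB : 0 < B)
    (hFB : tentNorm 1 F ≤ ENNReal.ofReal B) :
    ∃ g : (Fin n → ℝ) → ℝ, Integrable g volume ∧ (∀ y, 0 < g y) ∧
      ∫ y, g y ≤ (2 ^ n + 1) * B ∧ ∀ Q, F Q ≤ ∫ y in cube Q, g y := by
  classical
  obtain ⟨h', hh0', hhm, hhB⟩ := exists_pos_lintegral_lt_of_sigmaFinite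
    (volume : Measure (Fin n → ℝ)) (ENNReal.ofReal_pos.2 hB).ne'
  set h : (Fin n → ℝ) → ℝ := fun y => h' y with hh
  have hh0 : ∀ y, 0 < h y := fun y => hh0' y
  have hhi : Integrable h volume :=
    ⟨hhm.coe_nnreal_real.aestronglyMeasurable, by
      simpa [HasFiniteIntegral, hh] using hhB.trans ENNReal.ofReal_lt_top⟩
  have hhint : ∫ y, h y ≤ B := by
    rw [integral_eq_lintegral_of_nonneg_ae (.of_forall fun y => (hh0 y).le) hhi.1]
    refine ENNReal.toReal_le_of_le_ofReal hB.le ?_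
    simpa [hh] using hhB.le
  have hHc := continuous_setIntegral_cube hhi.locallyIntegrable
  -- the net: cubes `P` that lie well inside `Q`, with `F P` almost as large as `F Q`
  obtain ⟨t, ht⟩ := hFc.isCompact.elim_finite_subcover
    (fun i : UpperHalfSpace n × Set.Ioi (0 : ℝ) =>
      {Q | dist i.1.1 Q.1 + i.1.2 + i.2 < (Q.2 : ℝ)} ∩ {Q | F Q < F i.1 + ∫ y in cube Q, h y})
    (fun i => (isOpen_lt (by fun_prop) (by fun_prop)).inter
      (isOpen_lt hF (continuous_const.add hHc))) (by
      intro Q _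
      let γ : ℝ → UpperHalfSpace n := fun c =>
        (Q.1, ⟨Q.2 * Real.exp (-c), mul_pos Q.2.2 (Real.exp_pos _)⟩)
      have hγ : Continuous γ := by fun_prop
      have hγ0 : γ 0 = Q := by ext <;> simp [γ]
      have hev : ∀ᶠ c in 𝓝[>] (0 : ℝ), F Q < F (γ c) + ∫ y in cube Q, h y := by
        refine Filter.Eventually.filter_mono nhdsWithin_le_nhds ?_
        refine ((hF.comp hγ).add continuous_const).continuousAt.eventually_const_lt ?_
        simpa [hγ0] using setIntegral_cube_pos hhi hh0 Q
      obtain ⟨c, hc, hc0⟩ := (hev.and self_mem_nhdsWithin).exists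
      have hlt : (Q.2 : ℝ) * Real.exp (-c) < Q.2 :=
        mul_lt_of_lt_one_right Q.2.2 (Real.exp_lt_one_iff.2 (neg_lt_zero.2 hc0))
      refine Set.mem_iUnion.2 ⟨(γ c, ⟨((Q.2 : ℝ) - Q.2 * Real.exp (-c)) / 2, ?_⟩), ?_, hc⟩
      · exact half_pos (sub_pos.2 hlt)
      · simp only [Set.mem_ofPred_eq, γ, dist_self]
        linarith)
  obtain ⟨η, hη⟩ : ∃ η : Set.Ioi (0 : ℝ), ∀ i ∈ t, η ≤ i.2 := by
    obtain ⟨M, hM⟩ := (t.image fun i => OrderDual.toDual i.2).exists_le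
    exact ⟨OrderDual.ofDual M, fun i hi => hM _ (Finset.mem_image_of_mem _ hi)⟩
  obtain ⟨r, hr, ⟨S, hSd, -, hS⟩, hdom⟩ := exists_weights_of_finset (t.image Prod.fst) F
  have hSB : ∑ v ∈ S, F v ≤ B := by
    rw [← ENNReal.ofReal_le_ofReal_iff hB.le, ENNReal.ofReal_sum_of_nonneg fun v _ => hF0 v]
    refine le_trans (le_of_eq ?_) ((sum_enorm_le_tentNorm_one F hSd).trans hFB)
    exact Finset.sum_congr rfl fun v _ => (Real.enorm_of_nonneg (hF0 v)).symm
  -- the normalised indicator of the cube of radius `η` around `z`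
  let b : (Fin n → ℝ) → (Fin n → ℝ) → ℝ := fun z =>
    (cube (z, η)).indicator fun _ => (volume.real (cube (z, η)))⁻¹
  have hbi : ∀ z, Integrable (b z) volume := fun z => integrable_indicator_cube (z, η)
  have hb0 : ∀ z y, 0 ≤ b z y := fun z y =>
    Set.indicator_nonneg (fun _ _ => by positivity) y
  have hb1 : ∀ z, ∫ y, b z y = 1 := fun z => integral_indicator_cube (z, η)
  have hbQ : ∀ z (Q : UpperHalfSpace n), cube (z, η) ⊆ cube Q → ∫ y in cube Q, b z y = 1 :=
    fun z Q hz => by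
      rw [← hb1 z]
      refine setIntegral_eq_integral_of_forall_compl_eq_zero fun y hy => ?_
      exact Set.indicator_of_notMem (fun hy' => hy (hz hy')) _
  let g : (Fin n → ℝ) → ℝ := fun y =>
    ∑ v ∈ t.image Prod.fst, r v * ∑ σ, b (corner v σ) y + h y
  have hgi1 : ∀ v : UpperHalfSpace n,
      Integrable (fun y => r v * ∑ σ, b (corner v σ) y) volume := fun v =>
    (integrable_finsetSum _ fun σ _ => hbi (corner v σ)).const_mul _
  have hg0 : ∀ v y, 0 ≤ r v * ∑ σ, b (corner v σ) y := fun v y =>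
    mul_nonneg (hr v) (Finset.sum_nonneg fun σ _ => hb0 _ _)
  have hgi : Integrable g volume := (integrable_finsetSum _ fun v _ => hgi1 v).add hhi
  have hgpos : ∀ y, 0 < g y := fun y =>
    add_pos_of_nonneg_of_pos (Finset.sum_nonneg fun v _ => hg0 v y) (hh0 y)
  refine ⟨g, hgi, hgpos, ?_, fun Q => ?_⟩
  · simp only [g]
    rw [integral_add (integrable_finsetSum _ fun v _ => hgi1 v) hhi,
      integral_finsetSum _ fun v _ => hgi1 v]
    have : ∀ v : UpperHalfSpace n, ∫ y, r v * ∑ σ, b (corner v σ) y = r v * 2 ^ n := by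
      intro v
      rw [integral_const_mul, integral_finsetSum _ fun σ _ => hbi (corner v σ)]
      simp [hb1]
    simp only [this]
    rw [← Finset.sum_mul]
    have hle : (∑ v ∈ t.image Prod.fst, r v) * 2 ^ n ≤ B * 2 ^ n :=
      mul_le_mul_of_nonneg_right (hS.trans hSB) (by positivity)
    linarith
  · by_cases hQ : Q ∈ tsupport F
    · obtain ⟨i, hi, hi1, hi2⟩ := Set.mem_iUnion₂.1 (ht hQ)
      have hηi : (η : ℝ) ≤ i.2 := hη i hi
      simp only [g]
      rw [integral_add (integrable_finsetSum _ fun v _ => hgi1 v).integrableOn hhi.integrableOn,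
        integral_finsetSum _ fun v _ => (hgi1 v).integrableOn]
      refine hi2.le.trans (add_le_add_left
        ((hdom i.1 (Finset.mem_image_of_mem _ hi)).trans ?_) _)
      have hnn : ∀ v : UpperHalfSpace n,
          0 ≤ ∫ y in cube Q, r v * ∑ σ, b (corner v σ) y := fun v =>
        integral_nonneg fun y => hg0 v y
      refine le_trans (Finset.sum_le_sum fun v hv => ?_)
        (Finset.sum_le_sum_of_subset_of_nonneg (Finset.filter_subset _ _) fun v _ _ => hnn v)
      obtain ⟨-, hv1, hv2⟩ := Finset.mem_filter.1 hv
      obtain ⟨σ, hσ⟩ := exists_corner_mem_cube hv1 hv2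
      rw [integral_const_mul, integral_finsetSum _ fun σ _ => (hbi (corner v σ)).integrableOn]
      refine le_mul_of_one_le_right (hr v) ?_
      have hsub : cube (corner v σ, η) ⊆ cube Q := by
        refine Metric.closedBall_subset_closedBall' ?_
        have hd : dist (corner v σ) i.1.1 ≤ i.1.2 := hσ
        have hi1' : dist i.1.1 Q.1 + i.1.2 + i.2 < (Q.2 : ℝ) := hi1
        have := dist_triangle (corner v σ) i.1.1 Q.1
        simp only
        linarith
      rw [← hbQ _ Q hsub]
      exact Finset.single_le_sum (f := fun σ => ∫ y in cube Q, b (corner v σ) y)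
        (fun σ _ => integral_nonneg fun y => hb0 _ _) (Finset.mem_univ σ)
    · rw [image_eq_zero_of_notMem_tsupport hQ]
      exact integral_nonneg fun y => (hgpos y).le

/-! ### Decomposition in `S¹` -/

theorem TentHasSum.tendstoUniformly {u : ℕ → UpperHalfSpace n → ℝ} {F : UpperHalfSpace n → ℝ}
    (h : TentHasSum 1 u F) :
    TendstoUniformly (fun (N : ℕ) Q => ∑ i ∈ Finset.range N, u i Q) F atTop := by
  rw [EMetric.tendstoUniformly_iff]
  intro ε hε
  filter_upwards [h.2.2.eventually_lt_const hε] with N hN Q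
  rw [edist_eq_enorm_sub]
  exact (enorm_le_tentNorm_one (fun Q => F Q - ∑ i ∈ Finset.range N, u i Q) Q).trans_lt hN

/-- An exhaustion of the half-space in the spatial variable by continuous cutoffs `X k`, so sparse
that the parts of `F` cut off decay geometrically in `S¹`. -/
theorem exists_cutoffs {F : UpperHalfSpace n → ℝ} {T : ℝ}
    (hT : ∀ Q : UpperHalfSpace n, T < Q.2 → F Q = 0) {B : ℝ} (hB : 0 < B)
    (hFB : tentNorm 1 F ≤ ENNReal.ofReal B) :
    ∃ X : ℕ → UpperHalfSpace n → ℝ, (∀ Q, X 0 Q = 0) ∧ (∀ k, Continuous (X k)) ∧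
      (∀ k Q, X k Q ≤ X (k + 1) Q) ∧ (∀ k Q, X k Q ≤ 1) ∧
      (∀ k, ∃ R : ℝ, ∀ Q : UpperHalfSpace n, R < ‖Q.1‖ → X k Q = 0) ∧
      ∀ k, tentNorm 1 (fun Q => F Q * (1 - X k Q)) ≤ ENNReal.ofReal (B * (1 / 2) ^ k) := by
  let χ : ℕ → UpperHalfSpace n → ℝ := fun R Q => max 0 (min 1 (R + 1 - ‖Q.1‖))
  have hχ0 : ∀ R Q, 0 ≤ χ R Q := fun R Q => le_max_left _ _
  have hχ1 : ∀ R Q, χ R Q ≤ 1 := fun R Q => max_le zero_le_one (min_le_left _ _)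
  have htail : ∀ k : ℕ, ∃ N : ℕ, ∀ R ≥ N, tentNorm 1 (fun Q => F Q * (1 - χ R Q)) ≤
      ENNReal.ofReal (B * (1 / 2) ^ (k + 1)) := by
    intro k
    obtain ⟨R₀, hR₀⟩ := exists_tentNorm_one_tail_le (ne_top_of_le_ne_top ENNReal.ofReal_ne_top hFB)
      hT (ENNReal.ofReal_pos.2 (show 0 < B * (1 / 2) ^ (k + 1) by positivity)).ne'
    obtain ⟨N, hN⟩ := exists_nat_ge R₀
    refine ⟨N, fun R hR => hR₀ R (hN.trans (by exact_mod_cast hR)) _ (fun Q => ?_) fun Q hQ => ?_⟩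
    · rw [abs_mul]
      refine mul_le_of_le_one_right (abs_nonneg _) (abs_le.2 ⟨?_, ?_⟩) <;>
        linarith [hχ0 R Q, hχ1 R Q]
    · have : χ R Q = 1 := by
        simp only [χ]
        rw [min_eq_left (by linarith), max_eq_right zero_le_one]
      simp [this]
  obtain ⟨φ, hφ, hφt⟩ := extraction_forall_of_eventually' htail
  refine ⟨fun k => Nat.casesOn k 0 fun k => χ (φ k), fun Q => rfl, ?_, ?_, ?_, ?_, ?_⟩
  · rintro (_ | k)
    · exact continuous_const
    · simp only [χ]
      fun_prop
  · rintro (_ | k) Q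
    · exact hχ0 _ _
    · have hle : (φ k : ℝ) ≤ φ (k + 1) := by exact_mod_cast (hφ k.lt_succ_self).le
      exact max_le_max le_rfl (min_le_min le_rfl (by linarith))
  · rintro (_ | k) Q
    · exact zero_le_one
    · exact hχ1 _ _
  · rintro (_ | k)
    · exact ⟨0, fun _ _ => rfl⟩
    · refine ⟨φ k + 1, fun Q hQ => max_eq_left ((min_le_right _ _).trans (by linarith))⟩
  · rintro (_ | k)
    · simpa using hFB
    · exact hφt k

theorem isCompact_strip (R t₀ t₁ : ℝ) (ht₀ : 0 < t₀) :
    IsCompact {Q : UpperHalfSpace n | ‖Q.1‖ ≤ R ∧ t₀ ≤ (Q.2 : ℝ) ∧ (Q.2 : ℝ) ≤ t₁} := by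
  have h : IsCompact ((↑) ⁻¹' Set.Icc t₀ t₁ : Set (Set.Ioi (0 : ℝ))) := by
    rw [Topology.IsEmbedding.subtypeVal.isCompact_iff, Subtype.image_preimage_coe,
      Set.inter_eq_right.2 (show Set.Icc t₀ t₁ ⊆ Set.Ioi 0 from fun x hx => ht₀.trans_le hx.1)]
    exact isCompact_Icc
  convert (isCompact_closedBall (0 : Fin n → ℝ) R).prod h using 1
  ext Q
  simp

/-- The decomposition of a continuous `G ≥ 0` that vanishes on small and on large cubes and for
which `|Q| G(Q)` lies in `S¹`. -/
theorem exists_decomposition {G : UpperHalfSpace n → ℝ} (hG : Continuous G) (hG0 : ∀ Q, 0 ≤ G Q)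
    {t₀ t₁ : ℝ} (ht₀ : 0 < t₀) (hGs : ∀ Q, G Q ≠ 0 → t₀ ≤ (Q.2 : ℝ) ∧ (Q.2 : ℝ) ≤ t₁)
    {B : ℝ} (hB : 0 < B)
    (hGB : tentNorm 1 (fun Q => volume.real (cube Q) * G Q) ≤ ENNReal.ofReal B) :
    ∃ (lam : ℕ → ℝ) (g : ℕ → (Fin n → ℝ) → ℝ)
      (a : ℕ → CompactlySupportedContinuousMap (UpperHalfSpace n) ℝ),
      (∀ i, 0 < lam i) ∧ (∀ i, Integrable (g i) volume ∧ ∫ y, |g i y| = 1) ∧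
      (∀ i Q, |a i Q| ≤ 1) ∧
      (∀ Q, HasSum (fun i => lam i * a i Q * ⨍ y in cube Q, g i y) (G Q)) ∧
      (Summable lam ∧ ∑' i, lam i ≤ 2 * (2 ^ n + 1) * B) ∧
      TentHasSum 1 (fun i Q => lam i * a i Q * ⨍ y in cube Q, g i y) G ∧
      TentHasSum 1 (fun i Q => lam i * a i Q * ∫ y in cube Q, g i y)
        (fun Q => volume.real (cube Q) * G Q) := by
  set F : UpperHalfSpace n → ℝ := fun Q => volume.real (cube Q) * G Q with hF
  have hFc : Continuous F := continuous_measureReal_cube.mul hG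
  have hF0 : ∀ Q, 0 ≤ F Q := fun Q => mul_nonneg measureReal_nonneg (hG0 Q)
  have hFtop : tentNorm 1 F < ∞ := hGB.trans_lt ENNReal.ofReal_lt_top
  obtain ⟨X, hX0, hXc, hXm, hX1, hXs, hXt⟩ := exists_cutoffs (T := t₁) (fun Q hQ => by
    have : G Q = 0 := by
      by_contra h
      exact absurd (hGs Q h).2 (not_le.2 hQ)
    simp [hF, this]) hB hGB
  have hXnn : ∀ k Q, 0 ≤ X k Q := fun k Q => by
    rw [← hX0 Q]
    exact monotone_nat_of_le_succ (fun k => hXm k Q) k.zero_le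
  let D : ℕ → UpperHalfSpace n → ℝ := fun k Q => X (k + 1) Q - X k Q
  have hD0 : ∀ k Q, 0 ≤ D k Q := fun k Q => sub_nonneg.2 (hXm k Q)
  have hDle : ∀ k Q, D k Q ≤ 1 - X k Q := fun k Q => sub_le_sub_right (hX1 _ Q) _
  have hD1 : ∀ k Q, D k Q ≤ 1 := fun k Q => (hDle k Q).trans (by linarith [hXnn k Q])
  have hDc : ∀ k, Continuous (D k) := fun k => (hXc _).sub (hXc k)
  have hDsum : ∀ N Q, ∑ k ∈ Finset.range N, D k Q = X N Q := fun N Q => by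
    simp only [D]
    rw [Finset.sum_range_sub (fun k => X k Q), hX0, sub_zero]
  have hFDs : ∀ k, HasCompactSupport fun Q => F Q * D k Q := by
    intro k
    obtain ⟨R, hR⟩ := hXs k
    obtain ⟨R', hR'⟩ := hXs (k + 1)
    refine HasCompactSupport.intro (isCompact_strip (max R R') t₀ t₁ ht₀) fun Q hQ => ?_
    by_contra h
    obtain ⟨h1, h2⟩ := mul_ne_zero_iff.1 h
    refine hQ ⟨?_, hGs Q (mul_ne_zero_iff.1 h1).2⟩
    by_contra h3
    obtain ⟨h4, h5⟩ := max_lt_iff.1 (not_le.1 h3)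
    exact h2 (by simp [D, hR Q h4, hR' Q h5])
  have hFDB : ∀ k, tentNorm 1 (fun Q => F Q * D k Q) ≤ ENNReal.ofReal (B * (1 / 2) ^ k) :=
    fun k => (tentNorm_one_mono fun Q => by
      rw [abs_of_nonneg (mul_nonneg (hF0 Q) (hD0 k Q)),
        abs_of_nonneg (mul_nonneg (hF0 Q) ((hD0 k Q).trans (hDle k Q)))]
      exact mul_le_mul_of_nonneg_left (hDle k Q) (hF0 Q)).trans (hXt k)
  choose γ hγi hγ0 hγB hγF using fun k => exists_dominating_density (hFc.mul (hDc k)) (hFDs k)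
    (fun Q => mul_nonneg (hF0 Q) (hD0 k Q)) (show 0 < B * (1 / 2) ^ k by positivity) (hFDB k)
  have hI0 : ∀ k (Q : UpperHalfSpace n), 0 < ∫ y in cube Q, γ k y :=
    fun k => setIntegral_cube_pos (hγi k) (hγ0 k)
  have hIc : ∀ k, Continuous fun Q : UpperHalfSpace n => ∫ y in cube Q, γ k y :=
    fun k => continuous_setIntegral_cube (hγi k).locallyIntegrable
  let lam : ℕ → ℝ := fun k => ∫ y, γ k y
  have hlam : ∀ k, 0 < lam k := fun k => by
    refine (integral_pos_iff_support_of_nonneg (fun y => (hγ0 k y).le) (hγi k)).2 ?_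
    rw [Set.eq_univ_of_forall (s := Function.support (γ k)) fun y => (hγ0 k y).ne']
    exact Measure.measure_univ_pos.2 (NeZero.ne _)
  let g : ℕ → (Fin n → ℝ) → ℝ := fun k y => (lam k)⁻¹ * γ k y
  let a : ℕ → CompactlySupportedContinuousMap (UpperHalfSpace n) ℝ := fun k =>
    { toFun := fun Q => F Q * D k Q * (∫ y in cube Q, γ k y)⁻¹
      continuous_toFun := (hFc.mul (hDc k)).mul ((hIc k).inv₀ fun Q => (hI0 k Q).ne')
      hasCompactSupport' := (hFDs k).mul_right }
  have ha : ∀ k Q, a k Q = F Q * D k Q * (∫ y in cube Q, γ k y)⁻¹ := fun _ _ => rfl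
  have hint : ∀ k Q, lam k * a k Q * ∫ y in cube Q, g k y = F Q * D k Q := fun k Q => by
    have h1 := (hI0 k Q).ne'
    have h2 := (hlam k).ne'
    rw [ha, integral_const_mul]
    field_simp
  have havg : ∀ k Q, lam k * a k Q * ⨍ y in cube Q, g k y = G Q * D k Q := fun k Q => by
    have h1 := (measureReal_cube_pos Q).ne'
    rw [setAverage_eq, smul_eq_mul, mul_left_comm, hint]
    simp only [hF]
    field_simp
  -- on the support of `G` the volume of cubes is bounded below
  set K : ℝ := ((2 * t₀) ^ n)⁻¹ with hK
  have hK0 : 0 ≤ K := by positivity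
  have hGF : ∀ Q (c : ℝ), |G Q * c| ≤ K * |F Q * c| := fun Q c => by
    rcases eq_or_ne (G Q) 0 with h | h
    · simp [hF, h]
    · have hV : (2 * t₀) ^ n ≤ volume.real (cube Q) := by
        rw [measureReal_cube]
        gcongr
        exact (hGs Q h).1
      have hKV : 1 ≤ K * volume.real (cube Q) := by
        rw [hK, inv_mul_eq_div, one_le_div (by positivity)]
        exact hV
      simp only [hF]
      rw [mul_assoc, abs_mul (volume.real (cube Q)), abs_of_pos (measureReal_cube_pos Q),
        ← mul_assoc]
      exact le_mul_of_one_le_left (abs_nonneg _) hKV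
  have hGtop : tentNorm 1 G < ∞ :=
    (tentNorm_one_le_mul hK0 fun Q => by simpa using hGF Q 1).trans_lt
      (ENNReal.mul_lt_top ENNReal.ofReal_lt_top hFtop)
  have hterm : ∀ (H : UpperHalfSpace n → ℝ) k Q, |H Q * D k Q| ≤ |H Q| := fun H k Q => by
    rw [abs_mul, abs_of_nonneg (hD0 k Q)]
    exact mul_le_of_le_one_right (abs_nonneg _) (hD1 k Q)
  have hgeom : Tendsto (fun k : ℕ => ENNReal.ofReal (B * (1 / 2) ^ k)) atTop (𝓝 0) := by
    rw [← ENNReal.ofReal_zero]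
    refine ENNReal.tendsto_ofReal ?_
    simpa using (tendsto_pow_atTop_nhds_zero_of_lt_one (r := (1 / 2 : ℝ)) (by norm_num)
      (by norm_num)).const_mul B
  have hrem : ∀ (H : UpperHalfSpace n → ℝ) N Q,
      H Q - ∑ k ∈ Finset.range N, H Q * D k Q = H Q * (1 - X N Q) := fun H N Q => by
    rw [← Finset.mul_sum, hDsum]
    ring
  have htF : Tendsto (fun N => tentNorm 1 fun Q => F Q * (1 - X N Q)) atTop (𝓝 0) :=
    tendsto_of_tendsto_of_tendsto_of_le_of_le tendsto_const_nhds hgeom (fun _ => zero_le) hXt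
  have htG : Tendsto (fun N => tentNorm 1 fun Q => G Q * (1 - X N Q)) atTop (𝓝 0) := by
    refine tendsto_of_tendsto_of_tendsto_of_le_of_le tendsto_const_nhds ?_ (fun _ => zero_le)
      fun N => tentNorm_one_le_mul hK0 fun Q => hGF Q (1 - X N Q)
    simpa using ENNReal.Tendsto.const_mul htF (Or.inr ENNReal.ofReal_ne_top)
  have hsumG : TentHasSum 1 (fun i Q => lam i * a i Q * ⨍ y in cube Q, g i y) G := by
    simp only [TentHasSum, MemTent, havg, hrem]
    exact ⟨fun k => ⟨hG.mul (hDc k), (tentNorm_one_mono (hterm G k)).trans_lt hGtop⟩,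
      ⟨hG, hGtop⟩, htG⟩
  have hsumF : TentHasSum 1 (fun i Q => lam i * a i Q * ∫ y in cube Q, g i y) F := by
    simp only [TentHasSum, MemTent, hint, hrem]
    exact ⟨fun k => ⟨hFc.mul (hDc k), (tentNorm_one_mono (hterm F k)).trans_lt hFtop⟩,
      ⟨hFc, hFtop⟩, htF⟩
  have hlamB : ∀ k, lam k ≤ (2 ^ n + 1) * B * (1 / 2) ^ k := fun k =>
    (hγB k).trans_eq (by ring)
  have hgs : HasSum (fun k : ℕ => (2 ^ n + 1) * B * (1 / 2) ^ k) ((2 ^ n + 1) * B * 2) :=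
    hasSum_geometric_two.mul_left _
  have hlams : Summable lam := .of_nonneg_of_le (fun k => (hlam k).le) hlamB hgs.summable
  refine ⟨lam, g, a, hlam, fun k => ⟨(hγi k).const_mul _, ?_⟩, fun k Q => ?_, fun Q => ?_,
    ⟨hlams, ?_⟩, hsumG, hsumF⟩
  · have habs : ∀ y, |g k y| = (lam k)⁻¹ * γ k y := fun y =>
      abs_of_pos (mul_pos (inv_pos.2 (hlam k)) (hγ0 k y))
    simp only [habs]
    rw [integral_const_mul]
    exact inv_mul_cancel₀ (hlam k).ne'
  · have hFD := mul_nonneg (hF0 Q) (hD0 k Q)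
    rw [ha, ← div_eq_mul_inv, abs_of_nonneg (div_nonneg hFD (hI0 k Q).le)]
    exact div_le_one_of_le₀ (hγF k Q) (hI0 k Q).le
  · refine (hasSum_iff_tendsto_nat_of_nonneg (fun k => ?_) _).2
      (hsumG.tendstoUniformly.tendsto_at Q)
    rw [havg]
    exact mul_nonneg (hG0 Q) (hD0 k Q)
  · refine (hlams.tsum_le_tsum hlamB hgs.summable).trans_eq ?_
    rw [hgs.tsum_eq]
    ring

end JNp

theorem mainTheorem4 (n : ℕ) :
    ∃ C : ℝ, 0 < C ∧
      ∀ (𝕜 : Type) [RCLike 𝕜] (p : ℝ) (f : (Fin n → ℝ) → 𝕜) (δ : ℝ),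
        1 < p → JNp.MemJN p f → 0 < δ → δ < 1 →
        ∃ (lam : ℕ → ℝ) (g : ℕ → (Fin n → ℝ) → ℝ)
          (a : ℕ → CompactlySupportedContinuousMap (JNp.UpperHalfSpace n) ℝ),
          (∀ i, 0 ≤ lam i) ∧
          (JNp.jnNorm p f ≠ 0 → ∀ i, 0 < lam i) ∧
          (∀ i, Integrable (g i) volume ∧ ∫ y, |g i y| = 1) ∧
          (∀ i Q, |a i Q| ≤ 1) ∧
          (∀ Q : JNp.UpperHalfSpace n, δ < JNp.sideLength Q → JNp.sideLength Q < δ⁻¹ →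
            HasSum (fun i => lam i * a i Q * ⨍ y in JNp.cube Q, g i y) (JNp.osc f Q ^ p)) ∧
          (Summable lam ∧ ∑' i, lam i ≤ C * (JNp.jnNorm p f).toReal ^ p) ∧
          (∃ G : JNp.UpperHalfSpace n → ℝ,
            (∀ Q : JNp.UpperHalfSpace n, δ < JNp.sideLength Q → JNp.sideLength Q < δ⁻¹ →
              G Q = JNp.osc f Q ^ p) ∧
            JNp.TentHasSum 1 (fun i Q => lam i * a i Q * ⨍ y in JNp.cube Q, g i y) G ∧
            JNp.TentHasSum 1 (fun i Q => lam i * a i Q * ∫ y in JNp.cube Q, g i y)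
              (fun Q => volume.real (JNp.cube Q) * G Q) ∧
            TendstoUniformly
              (fun (N : ℕ) Q => ∑ i ∈ Finset.range N, lam i * a i Q * ⨍ y in JNp.cube Q, g i y)
              G atTop) := by
  refine ⟨2 * (2 ^ n + 1), by positivity, fun 𝕜 _ p f δ hp hf hδ _ => ?_⟩
  have hp0 : 0 < p := by linarith
  have hpow : ENNReal.ofReal ((JNp.jnNorm p f).toReal ^ p) = JNp.jnNorm p f ^ p := by
    rw [← ENNReal.ofReal_rpow_of_nonneg ENNReal.toReal_nonneg hp0.le,
      ENNReal.ofReal_toReal hf.2.ne]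
  have hcard : ∀ 𝒞 : Finset (JNp.UpperHalfSpace n),
      (𝒞 : Set (JNp.UpperHalfSpace n)).PairwiseDisjoint JNp.cube →
      ∑ Q ∈ 𝒞, ‖volume.real (JNp.cube Q) * JNp.osc f Q ^ p‖ₑ ≤ JNp.jnNorm p f ^ p := by
    intro 𝒞 h𝒞
    rw [JNp.jnNorm, ← ENNReal.rpow_mul, one_div_mul_cancel hp0.ne', ENNReal.rpow_one]
    refine le_trans (le_of_eq (Finset.sum_congr rfl fun Q _ => ?_)) (le_iSup₂ (f := fun
      (𝒞 : Finset (JNp.UpperHalfSpace n))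
      (_ : (𝒞 : Set (JNp.UpperHalfSpace n)).PairwiseDisjoint JNp.cube) =>
        ∑ Q ∈ 𝒞, ENNReal.ofReal (JNp.osc f Q) ^ p * volume (JNp.cube Q)) 𝒞 h𝒞)
    rw [Real.enorm_of_nonneg (mul_nonneg measureReal_nonneg
      (Real.rpow_nonneg (JNp.osc_nonneg f Q) p)), ENNReal.ofReal_mul measureReal_nonneg,
      ENNReal.ofReal_rpow_of_nonneg (JNp.osc_nonneg f Q) hp0.le, ofReal_measureReal
      (JNp.measure_cube_ne_top Q), mul_comm]
  -- a cutoff in the side length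
  obtain ⟨φ, hφ1, hφ0, -, hφI⟩ := exists_continuous_one_zero_of_isCompact
    (isCompact_Icc (a := δ) (b := δ⁻¹)) (isOpen_Ioo (a := δ / 2) (b := δ⁻¹ + 1)).isClosed_compl
    (Set.disjoint_compl_right_iff_subset.2
      (Set.Icc_subset_Ioo (by linarith) (by linarith)))
  set G : JNp.UpperHalfSpace n → ℝ := fun Q => φ (JNp.sideLength Q) * JNp.osc f Q ^ p with hG
  have hGosc : ∀ Q : JNp.UpperHalfSpace n, δ < JNp.sideLength Q → JNp.sideLength Q < δ⁻¹ →
      G Q = JNp.osc f Q ^ p := fun Q h1 h2 => by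
    simp [hG, hφ1 (Set.mem_Icc.2 ⟨h1.le, h2.le⟩)]
  have hosc0 : ∀ Q, 0 ≤ JNp.osc f Q ^ p := fun Q => Real.rpow_nonneg (JNp.osc_nonneg f Q) p
  have hG0 : ∀ Q, 0 ≤ G Q := fun Q => mul_nonneg (hφI _).1 (hosc0 Q)
  have hGc : Continuous G := by
    refine (φ.continuous.comp ?_).mul
      ((JNp.continuous_osc hf.1).rpow_const fun _ => Or.inr hp0.le)
    unfold JNp.sideLength
    fun_prop
  have hGs : ∀ Q, G Q ≠ 0 → δ / 4 ≤ (Q.2 : ℝ) ∧ (Q.2 : ℝ) ≤ (δ⁻¹ + 1) / 2 := fun Q hQ => by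
    have hmem : JNp.sideLength Q ∈ Set.Ioo (δ / 2) (δ⁻¹ + 1) := by
      by_contra h
      exact hQ (by simp [hG, hφ0 h])
    rw [JNp.sideLength] at hmem
    constructor <;> linarith [hmem.1, hmem.2]
  have hGB : JNp.tentNorm 1 (fun Q => volume.real (JNp.cube Q) * G Q) ≤ JNp.jnNorm p f ^ p := by
    refine (JNp.tentNorm_one_mono
      (F := fun Q => volume.real (JNp.cube Q) * JNp.osc f Q ^ p) fun Q => ?_).trans ?_
    · rw [abs_of_nonneg (mul_nonneg measureReal_nonneg (hG0 Q)),
        abs_of_nonneg (mul_nonneg measureReal_nonneg (hosc0 Q))]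
      exact mul_le_mul_of_nonneg_left (mul_le_of_le_one_left (hosc0 Q) (hφI _).2)
        measureReal_nonneg
    · rw [JNp.tentNorm_one]
      exact iSup₂_le hcard
  rcases eq_or_ne (JNp.jnNorm p f) 0 with h0 | h0
  · -- all oscillations vanish, and any admissible `g` serves with zero coefficients
    rw [h0, ENNReal.zero_rpow_of_pos hp0] at hcard
    have hz : ∀ Q : JNp.UpperHalfSpace n, JNp.osc f Q ^ p = 0 := fun Q => by
      have := hcard {Q} (by simp)
      simpa [(JNp.measureReal_cube_pos Q).ne'] using this
    let Q₁ : JNp.UpperHalfSpace n := (0, ⟨1, Set.mem_Ioi.2 one_pos⟩)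
    let g : (Fin n → ℝ) → ℝ := (JNp.cube Q₁).indicator fun _ => (volume.real (JNp.cube Q₁))⁻¹
    have hg1 : ∫ y, |g y| = 1 := by
      have habs : ∀ y, |g y| = g y := fun y =>
        abs_of_nonneg (Set.indicator_nonneg (fun _ _ => by positivity) y)
      simp only [habs]
      exact JNp.integral_indicator_cube Q₁
    have ht0 : JNp.tentNorm 1 (fun _ : JNp.UpperHalfSpace n => (0 : ℝ)) = 0 := by
      simp [JNp.tentNorm_one]
    have hT : JNp.TentHasSum 1 (fun _ _ => 0) (fun _ : JNp.UpperHalfSpace n => (0 : ℝ)) := by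
      simp [JNp.TentHasSum, JNp.MemTent, ht0, continuous_const]
    refine ⟨0, fun _ => g, 0, fun _ => le_rfl, fun h => absurd h0 h,
      fun _ => ⟨JNp.integrable_indicator_cube Q₁, hg1⟩, by simp,
      fun Q _ _ => ?_, ⟨summable_zero, ?_⟩, fun _ => 0, fun Q _ _ => (hz Q).symm, ?_⟩
    · simp [hz]
    · simp [h0, hp0.ne']
    · exact ⟨by simpa using hT, by simpa using hT, by simpa using hT.tendstoUniformly⟩
  · have hB : 0 < (JNp.jnNorm p f).toReal ^ p :=
      Real.rpow_pos_of_pos (ENNReal.toReal_pos h0 hf.2.ne) p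
    obtain ⟨lam, g, a, hlam, hg, ha, hsum, hlams, hT, hT'⟩ :=
      JNp.exists_decomposition hGc hG0 (by positivity) hGs hB (hGB.trans_eq hpow.symm)
    exact ⟨lam, g, a, fun i => (hlam i).le, fun _ => hlam, hg, ha,
      fun Q h1 h2 => hGosc Q h1 h2 ▸ hsum Q, hlams, G, hGosc, hT, hT', hT.tendstoUniformly⟩
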